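/- For $n\ge 1$ let $Q_n$ be the $n$-dimensional hypercube: the graph on all binary strings of length $n$, two strings being adjacent if and only if they differ in exactly one position. Let $K_{1,r}$ be the star with $r$ leaves. For a graph $G$ and a set $F$ of subgraphs of $G$ (not necessarily vertex-disjoint), let $G-F$ be the graph obtained from $G$ by deleting all vertices of all members of $F$; it is called disconnected if it has more than one connected component. For a connected graph $T$, let $\kappa(G,T)$ be the minimum cardinality of a set $F$ of subgraphs of $G$, each isomorphic to $T$, such that $G-F$ is disconnected (the $T$-structure connectivity of $G$), and let $\kappa^s(G,T)$ be the minimum cardinality of a set $F$ of subgraphs of $G$, each isomorphic to a connected subgraph of $T$, such that $G-F$ is disconnected (the $T$-substructure connectivity of $G$). **Theorem.** $\kappa(Q_6,K_{1,6})=\kappa^s(Q_6,K_{1,6})=3$ and $\kappa(Q_7,K_{1,6})=\kappa^s(Q_7,K_{1,6})=4$. -/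

import Mathlib

/-- The `n`-dimensional hypercube `Q_n`: its vertices are the binary strings of length `n`, and two
strings are adjacent iff they differ in exactly one position. -/
def hypercube (n : ℕ) : SimpleGraph (Fin n → Bool) where
  Adj u v := hammingDist u v = 1
  symm := ⟨fun u v h => by rw [hammingDist_comm]; exact h⟩
  loopless := ⟨fun u h => by simp at h⟩

/-- The star `K_{1,r}` with `r` leaves. -/
abbrev starGraphK (r : ℕ) : SimpleGraph (Fin 1 ⊕ Fin r) :=
  completeBipartiteGraph (Fin 1) (Fin r)

/-- `G - F`: the graph obtained from `G` by deleting all vertices of all members of a set `F` of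
subgraphs of `G`. -/
def deleteMembers {V : Type*} (G : SimpleGraph V) (F : Set G.Subgraph) :
    SimpleGraph {v : V // ∀ H ∈ F, v ∉ H.verts} :=
  G.induce {v : V | ∀ H ∈ F, v ∉ H.verts}

/-- `F` is a `T`-structure-cut of `G`: every member of `F` is isomorphic to `T`, and `G - F` is
disconnected, i.e. two of its vertices are not joined by a walk (it has more than one component;
the graph without vertices does not count as disconnected). -/
def IsStructureCut {V W : Type*} (G : SimpleGraph V) (T : SimpleGraph W)
    (F : Set G.Subgraph) : Prop :=
  (∀ H ∈ F, Nonempty (H.coe ≃g T)) ∧ ¬ (deleteMembers G F).Preconnected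

/-- `F` is a `T`-substructure-cut of `G`: every member of `F` is isomorphic to a connected
subgraph of `T`, and `G - F` is disconnected. -/
def IsSubstructureCut {V W : Type*} (G : SimpleGraph V) (T : SimpleGraph W)
    (F : Set G.Subgraph) : Prop :=
  (∀ H ∈ F, ∃ S : T.Subgraph, S.Connected ∧ Nonempty (H.coe ≃g S.coe)) ∧
    ¬ (deleteMembers G F).Preconnected

/-- The `T`-structure connectivity `κ(G, T)`: the minimum cardinality of a `T`-structure-cut of
`G` (`⊤` if there is none; a finite value is attained). -/
noncomputable def structureConnectivity {V W : Type*} (G : SimpleGraph V) (T : SimpleGraph W) :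
    ℕ∞ :=
  sInf {k : ℕ∞ | ∃ F : Set G.Subgraph, IsStructureCut G T F ∧ F.encard = k}

/-- The `T`-substructure connectivity `κˢ(G, T)`: the minimum cardinality of a
`T`-substructure-cut of `G` (`⊤` if there is none; a finite value is attained). -/
noncomputable def substructureConnectivity {V W : Type*} (G : SimpleGraph V)
    (T : SimpleGraph W) : ℕ∞ :=
  sInf {k : ℕ∞ | ∃ F : Set G.Subgraph, IsSubstructureCut G T F ∧ F.encard = k}

namespace SimpleGraph

/-! A connected subgraph of a star lies in a ball of radius one about one of its own vertices. The
lower bounds therefore follow from a statement about balls, `hypercube.preconnected_induce`, proved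
by induction on the dimension with weight 2 for each centre and weight 1 for each single deleted
vertex. Split the cube along a coordinate: a ball centred in one half meets the other half in at
most one vertex, so it counts there with weight 1 only, and a single vertex does not count there at
all. If two deleted centres or vertices differ in the chosen coordinate, both halves lose weight and
are connected by induction; counting yields a surviving edge between them. The upper bounds isolate
the zero string: a star centred at a string of weight two covers up to two of its neighbours. -/

theorem Reachable.exists_adj_left {V : Type*} {G : SimpleGraph V} {u v : V}
    (h : G.Reachable u v) (huv : u ≠ v) : ∃ w, G.Adj u w := by
  obtain ⟨p⟩ := h
  cases p with
  | nil => exact absurd rfl huv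
  | cons h _ => exact ⟨_, h⟩

end SimpleGraph

/-! ### Hamming distance and the size of balls -/

namespace hypercube

theorem hammingDist_insertNth {n : ℕ} (i : Fin (n + 1)) (a b : Bool) (u v : Fin n → Bool) :
    hammingDist (i.insertNth a u : Fin (n + 1) → Bool) (i.insertNth b v) =
      (if a = b then 0 else 1) + hammingDist u v := by
  simp only [hammingDist, Finset.card_filter]
  rw [Fin.sum_univ_succAbove _ i]
  simp

theorem hammingDist_removeNth_le {n : ℕ} (i : Fin (n + 1)) (u v : Fin (n + 1) → Bool) :
    hammingDist (i.removeNth u) (i.removeNth v) ≤ hammingDist u v := by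
  have h := hammingDist_insertNth i (u i) (v i) (i.removeNth u) (i.removeNth v)
  rw [Fin.insertNth_self_removeNth, Fin.insertNth_self_removeNth] at h
  omega

theorem removeNth_eq_of_hammingDist_le_one {n : ℕ} {i : Fin (n + 1)} {u v : Fin (n + 1) → Bool}
    (h : hammingDist u v ≤ 1) (hi : u i ≠ v i) : i.removeNth u = i.removeNth v := by
  have h' := hammingDist_insertNth i (u i) (v i) (i.removeNth u) (i.removeNth v)
  rw [Fin.insertNth_self_removeNth, Fin.insertNth_self_removeNth, if_neg hi] at h'
  exact hammingDist_eq_zero.mp (by omega)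

/-- The string `u` with position `j` flipped. -/
def flip {n : ℕ} (u : Fin n → Bool) (j : Fin n) : Fin n → Bool :=
  Function.update u j (!u j)

theorem hammingDist_flip {n : ℕ} (u : Fin n → Bool) (j : Fin n) :
    hammingDist u (flip u j) = 1 := by
  rw [hammingDist, Finset.card_eq_one]
  refine ⟨j, Finset.ext fun k => ?_⟩
  rw [Finset.mem_filter_univ, Finset.mem_singleton]
  by_cases h : k = j
  · subst h; simp [flip]
  · simp [flip, h]

theorem eq_flip_of_hammingDist_eq_one {n : ℕ} {u v : Fin n → Bool} (h : hammingDist u v = 1) :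
    ∃ j, v = flip u j := by
  rw [hammingDist, Finset.card_eq_one] at h
  obtain ⟨j, hj⟩ := h
  have key (k : Fin n) : u k ≠ v k ↔ k = j := by
    simpa using congrArg (k ∈ ·) hj
  refine ⟨j, funext fun k => ?_⟩
  by_cases hk : k = j
  · subst hk
    have := (key k).mpr rfl
    simpa [flip] using Bool.eq_not_of_ne this.symm
  · have := mt (key k).mp hk
    simpa [flip, hk] using (not_not.mp this).symm

theorem card_ball_le {n : ℕ} (c : Fin n → Bool) :
    (Finset.univ.filter fun v => hammingDist c v ≤ 1).card ≤ n + 1 := by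
  have hsub : (Finset.univ.filter fun v => hammingDist c v ≤ 1) ⊆
      insert c (Finset.univ.image (flip c)) := by
    intro v hv
    rw [Finset.mem_filter] at hv
    rcases Nat.le_one_iff_eq_zero_or_eq_one.mp hv.2 with h | h
    · rw [hammingDist_eq_zero] at h
      simp [h]
    · obtain ⟨j, rfl⟩ := eq_flip_of_hammingDist_eq_one h
      simp
  refine (Finset.card_le_card hsub).trans ((Finset.card_insert_le _ _).trans ?_)
  simpa using Finset.card_image_le (s := Finset.univ) (f := flip c)

theorem mul_succ_lt_two_pow (n : ℕ) : n * (n + 1) < 2 * 2 ^ n := by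
  rcases lt_or_ge n 3 with h | h
  · interval_cases n <;> norm_num
  · induction n, h using Nat.le_induction with
    | base => norm_num
    | succ k hk ih => rw [pow_succ]; nlinarith

/-- If few balls and points cannot exhaust the cube, some string avoids all of them. -/
theorem exists_notMem_balls {n : ℕ} (S M : Finset (Fin n → Bool))
    (h : 2 * S.card + M.card ≤ n) :
    ∃ w, w ∉ M ∧ ∀ c ∈ S, 1 < hammingDist c w := by
  by_contra! hcon
  have hsub : (Finset.univ : Finset (Fin n → Bool)) ⊆
      M ∪ S.biUnion fun c => Finset.univ.filter fun v => hammingDist c v ≤ 1 := by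
    intro w _
    by_cases hw : w ∈ M
    · simp [hw]
    · obtain ⟨c, hc, hcw⟩ := hcon w hw
      simp only [Finset.mem_union, Finset.mem_biUnion, Finset.mem_filter, Finset.mem_univ,
        true_and]
      exact Or.inr ⟨c, hc, hcw⟩
  have hcard := (Finset.card_le_card hsub).trans (Finset.card_union_le _ _)
  have hS := Finset.card_biUnion_le_card_mul S
    (fun c => Finset.univ.filter fun v => hammingDist c v ≤ 1) (n + 1) fun c _ => card_ball_le c
  have huniv : (Finset.univ : Finset (Fin n → Bool)).card = 2 ^ n := by simp
  rw [huniv] at hcard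
  -- Multiplying `h` by `n + 1` bounds twice the size of the union by `n * (n + 1)`, which is less
  -- than `2 * 2 ^ n`.
  have hn := mul_succ_lt_two_pow n
  have : 2 * M.card ≤ (n + 1) * M.card := by
    rcases Nat.eq_zero_or_pos n with rfl | hpos
    · simp [show M.card = 0 by omega]
    · exact Nat.mul_le_mul_right _ (by omega)
  nlinarith

/-! ### Splitting the cube into two subcubes -/

section Split

variable {n : ℕ} (i : Fin (n + 1)) (A : Set (Fin (n + 1) → Bool))

/-- The trace of a set of strings on the subcube `x i = b`. -/
def slice (b : Bool) : Set (Fin n → Bool) :=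
  {w | i.insertNth b w ∈ A}

/-- The inclusion of a subcube, on the vertices that lie in `A`. -/
def sliceHom (b : Bool) :
    (hypercube n).induce (slice i A b) →g (hypercube (n + 1)).induce A where
  toFun w := ⟨i.insertNth b w.1, w.2⟩
  map_rel' {u v} h := by
    change hammingDist (i.insertNth b u.1 : Fin (n + 1) → Bool) (i.insertNth b v.1) = 1
    rw [hammingDist_insertNth, if_pos rfl, zero_add]
    exact h

variable {i A}

theorem reachable_of_slice_preconnected {b : Bool}
    (h : ((hypercube n).induce (slice i A b)).Preconnected) {u v : Fin (n + 1) → Bool}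
    (hu : u ∈ A) (hv : v ∈ A) (hub : u i = b) (hvb : v i = b) :
    ((hypercube (n + 1)).induce A).Reachable ⟨u, hu⟩ ⟨v, hv⟩ := by
  have eu : i.insertNth b (i.removeNth u) = u := by
    rw [← hub, Fin.insertNth_self_removeNth]
  have ev : i.insertNth b (i.removeNth v) = v := by
    rw [← hvb, Fin.insertNth_self_removeNth]
  have hr := (h ⟨i.removeNth u, by rw [slice, Set.mem_ofPred_eq, eu]; exact hu⟩
    ⟨i.removeNth v, by rw [slice, Set.mem_ofPred_eq, ev]; exact hv⟩).map (sliceHom i A b)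
  convert hr using 1
  · exact Subtype.ext eu.symm
  · exact Subtype.ext ev.symm

theorem adj_insertNth_not (b : Bool) (w : Fin n → Bool) :
    (hypercube (n + 1)).Adj (i.insertNth b w) (i.insertNth (!b) w) := by
  change hammingDist (i.insertNth b w : Fin (n + 1) → Bool) (i.insertNth (!b) w) = 1
  rw [hammingDist_insertNth, hammingDist_self]
  simp

/-- The two copies of `w` form a surviving edge that joins the connected halves. -/
theorem preconnected_of_slices
    (h : ∀ b, ((hypercube n).induce (slice i A b)).Preconnected)
    {w : Fin n → Bool} (hw : ∀ b, w ∈ slice i A b) :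
    ((hypercube (n + 1)).induce A).Preconnected := by
  rintro ⟨u, hu⟩ ⟨v, hv⟩
  have base (x : Fin (n + 1) → Bool) (hx : x ∈ A) :
      ((hypercube (n + 1)).induce A).Reachable ⟨x, hx⟩ ⟨i.insertNth true w, hw true⟩ := by
    cases hb : x i with
    | true => exact reachable_of_slice_preconnected (h true) hx (hw true) hb (by simp)
    | false =>
      refine (reachable_of_slice_preconnected (h false) hx (hw false) hb (by simp)).trans ?_
      exact SimpleGraph.Adj.reachable (adj_insertNth_not false w)
  exact (base u hu).trans (base v hv).symm

/-- Every survivor outside the connected half can step across into it. -/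
theorem preconnected_of_slice {b : Bool}
    (h : ((hypercube n).induce (slice i A b)).Preconnected)
    (hA : ∀ u ∈ A, u i = !b → i.removeNth u ∈ slice i A b) :
    ((hypercube (n + 1)).induce A).Preconnected := by
  have base (x : Fin (n + 1) → Bool) (hx : x ∈ A) :
      ∃ y, ∃ hy : y ∈ A, y i = b ∧
        ((hypercube (n + 1)).induce A).Reachable ⟨x, hx⟩ ⟨y, hy⟩ := by
    by_cases hb : x i = b
    · exact ⟨x, hx, hb, SimpleGraph.Reachable.refl _⟩
    · have hb' : x i = !b := Bool.eq_not_of_ne hb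
      refine ⟨i.insertNth b (i.removeNth x), hA x hx hb', by simp,
        SimpleGraph.Adj.reachable ?_⟩
      have := (adj_insertNth_not (i := i) b (i.removeNth x)).symm
      rw [← hb', Fin.insertNth_self_removeNth] at this
      exact this
  rintro ⟨u, hu⟩ ⟨v, hv⟩
  obtain ⟨u', hu', hub, hru⟩ := base u hu
  obtain ⟨v', hv', hvb, hrv⟩ := base v hv
  exact (hru.trans (reachable_of_slice_preconnected h hu' hv' hub hvb)).trans hrv.symm

end Split

/-- Deleting from `Q_n` sets of strings that are contained in balls of radius one and contain the
centres of these (the set of centres is `S`), and the strings in `M`, leaves a connected graph if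
`2 |S| + |M| < n`. -/
theorem preconnected_induce (n : ℕ) (S M : Finset (Fin n → Bool)) (A : Set (Fin n → Bool))
    (hS : ∀ c ∈ S, c ∉ A) (hM : ∀ c ∈ M, c ∉ A)
    (hA : ∀ v ∉ A, v ∈ M ∨ ∃ c ∈ S, hammingDist c v ≤ 1)
    (hcard : 2 * S.card + M.card ≤ n - 1) :
    ((hypercube n).induce A).Preconnected := by
  classical
  induction n with
  | zero =>
    rintro ⟨u, hu⟩ ⟨v, hv⟩
    obtain rfl : u = v := Subsingleton.elim u v
    exact SimpleGraph.Reachable.refl _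
  | succ n ih =>
    rw [Nat.add_sub_cancel] at hcard
    -- A centre in the opposite half becomes a single vertex, kept only if it is really deleted,
    -- since a star need not use all its leaves. By `hb` the weight drops by at least one or is
    -- already zero.
    have half (i : Fin (n + 1)) (b : Bool)
        (hb : (S = ∅ ∧ M = ∅) ∨ ∃ x ∈ S ∪ M, x i = !b) :
        ((hypercube n).induce (slice i A b)).Preconnected := by
      refine ih ((S.filter fun c => c i = b).image i.removeNth)
        (((M.filter fun c => c i = b).image i.removeNth) ∪
          ((S.filter fun c => ¬ c i = b).image i.removeNth).filter fun w => w ∉ slice i A b)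
        (slice i A b) ?_ ?_ ?_ ?_
      · intro w hw hwA
        obtain ⟨c, hc, rfl⟩ := Finset.mem_image.mp hw
        obtain ⟨hc', rfl⟩ := Finset.mem_filter.mp hc
        rw [slice, Set.mem_ofPred_eq, Fin.insertNth_self_removeNth] at hwA
        exact hS c hc' hwA
      · intro w hw hwA
        rcases Finset.mem_union.mp hw with hw | hw
        · obtain ⟨c, hc, rfl⟩ := Finset.mem_image.mp hw
          obtain ⟨hc', rfl⟩ := Finset.mem_filter.mp hc
          rw [slice, Set.mem_ofPred_eq, Fin.insertNth_self_removeNth] at hwA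
          exact hM c hc' hwA
        · exact (Finset.mem_filter.mp hw).2 hwA
      · intro w hw
        rcases hA _ hw with h | ⟨c, hc, hcw⟩
        · refine Or.inl (Finset.mem_union_left _ (Finset.mem_image.mpr
            ⟨_, Finset.mem_filter.mpr ⟨h, by simp⟩, by simp⟩))
        · by_cases hcb : c i = b
          · refine Or.inr ⟨_, Finset.mem_image_of_mem _ (Finset.mem_filter.mpr ⟨hc, hcb⟩), ?_⟩
            simpa using (hammingDist_removeNth_le i _ _).trans hcw
          · refine Or.inl (Finset.mem_union_right _ (Finset.mem_filter.mpr
              ⟨Finset.mem_image.mpr ⟨c, Finset.mem_filter.mpr ⟨hc, hcb⟩, ?_⟩, hw⟩))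
            simpa using removeNth_eq_of_hammingDist_le_one (i := i) hcw (by simpa using hcb)
      · have h1 := Finset.card_image_le (s := S.filter fun c => c i = b) (f := i.removeNth)
        have h2 := Finset.card_image_le (s := M.filter fun c => c i = b) (f := i.removeNth)
        have h3 := (Finset.card_filter_le
          ((S.filter fun c => ¬ c i = b).image i.removeNth) fun w => w ∉ slice i A b).trans
          Finset.card_image_le
        have h4 := Finset.card_union_le ((M.filter fun c => c i = b).image i.removeNth)
          (((S.filter fun c => ¬ c i = b).image i.removeNth).filter fun w => w ∉ slice i A b)
        have h5 := S.card_filter_add_card_filter_not fun c => c i = b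
        have h6 := M.card_filter_add_card_filter_not fun c => c i = b
        rcases hb with ⟨rfl, rfl⟩ | ⟨x, hx, hxb⟩
        · simp
        · have hxb' : ¬ x i = b := by simp [hxb]
          rcases Finset.mem_union.mp hx with hx | hx
          · have : 0 < (S.filter fun c => ¬ c i = b).card :=
              Finset.card_pos.mpr ⟨x, Finset.mem_filter.mpr ⟨hx, hxb'⟩⟩
            omega
          · have : 0 < (M.filter fun c => ¬ c i = b).card :=
              Finset.card_pos.mpr ⟨x, Finset.mem_filter.mpr ⟨hx, hxb'⟩⟩
            omega
    have both (i : Fin (n + 1)) (hi : ∀ b, (S = ∅ ∧ M = ∅) ∨ ∃ x ∈ S ∪ M, x i = !b) :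
        ((hypercube (n + 1)).induce A).Preconnected := by
      obtain ⟨w, hwM, hwS⟩ := exists_notMem_balls (S.image i.removeNth) (M.image i.removeNth)
        (by
          have h1 := Finset.card_image_le (s := S) (f := i.removeNth)
          have h2 := Finset.card_image_le (s := M) (f := i.removeNth)
          omega)
      refine preconnected_of_slices (i := i) (fun b => half i b (hi b)) (w := w) fun b => ?_
      by_contra hw
      rcases hA _ hw with h | ⟨c, hc, hcw⟩
      · exact hwM (Finset.mem_image.mpr ⟨_, h, by simp⟩)
      · have h1 := hwS _ (Finset.mem_image_of_mem _ hc)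
        have h2 := hammingDist_removeNth_le i c (i.insertNth b w)
        rw [Fin.removeNth_insertNth] at h2
        omega
    rcases (S ∪ M).eq_empty_or_nonempty with h0 | ⟨x, hx⟩
    · exact both 0 fun b => Or.inl (Finset.union_eq_empty.mp h0)
    by_cases hne : ∃ y ∈ S ∪ M, y ≠ x
    · obtain ⟨y, hy, hyx⟩ := hne
      obtain ⟨i, hi⟩ := Function.ne_iff.mp hyx
      refine both i fun b => Or.inr ?_
      by_cases hb : x i = !b
      · exact ⟨x, hx, hb⟩
      · refine ⟨y, hy, ?_⟩
        revert hi hb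
        cases x i <;> cases y i <;> cases b <;> simp
    -- Only `x` remains. In the half avoiding `x`, the only vertex that can be missing is the
    -- neighbour of `x`, so every survivor of the other half has its partner alive.
    · push Not at hne
      refine preconnected_of_slice (i := 0) (b := !x 0)
        (half 0 _ (Or.inr ⟨x, hx, by simp⟩)) fun u hu hux => ?_
      rw [Bool.not_not] at hux
      by_contra hw
      rcases hA _ hw with h | ⟨c, hc, hcw⟩
      · have := congrFun (hne _ (Finset.mem_union_right _ h)) 0
        simp at this
      · obtain rfl := hne c (Finset.mem_union_left _ hc)
        have h := removeNth_eq_of_hammingDist_le_one (i := 0) hcw (by simp)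
        rw [Fin.removeNth_insertNth] at h
        apply hS c hc
        rwa [← Fin.insertNth_self_removeNth 0 c, h, ← hux, Fin.insertNth_self_removeNth]

end hypercube

/-- A connected subgraph of a star has a vertex adjacent to all the others. -/
theorem SimpleGraph.Subgraph.Connected.exists_center {r : ℕ} {S : (starGraphK r).Subgraph}
    (hS : S.Connected) : ∃ s ∈ S.verts, ∀ t ∈ S.verts, t ≠ s → S.Adj s t := by
  have key {s t} (hs : s ∈ S.verts) (ht : t ∈ S.verts) (hts : t ≠ s) : ∃ x, S.Adj t x := by
    obtain ⟨x, hx⟩ := (hS.coe.preconnected ⟨t, ht⟩ ⟨s, hs⟩).exists_adj_left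
      (fun h => hts (congrArg Subtype.val h))
    exact ⟨x, hx⟩
  by_cases h0 : Sum.inl 0 ∈ S.verts
  · refine ⟨_, h0, fun t ht hts => ?_⟩
    obtain ⟨x, hx⟩ := key h0 ht hts
    have hadj := S.adj_sub hx
    rcases t with t | t
    · exact absurd (congrArg Sum.inl (Subsingleton.elim t 0)) hts
    · rcases x with x | x
      · rw [Subsingleton.elim x 0] at hx
        exact hx.symm
      · simp at hadj
  · obtain ⟨s, hs⟩ := hS.nonempty
    refine ⟨s, hs, fun t ht hts => absurd ?_ h0⟩
    obtain ⟨x, hx⟩ := key hs ht hts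
    have hadj := S.adj_sub hx
    rcases t with t | t
    · rwa [Subsingleton.elim t 0] at ht
    · rcases x with x | x
      · rw [Subsingleton.elim x 0] at hx
        exact hx.snd_mem
      · simp at hadj

/-! ### Lower bound for substructure cuts -/

namespace hypercube

theorem exists_center {n r : ℕ} {H : (hypercube n).Subgraph}
    (hH : ∃ S : (starGraphK r).Subgraph, S.Connected ∧ Nonempty (H.coe ≃g S.coe)) :
    ∃ c ∈ H.verts, ∀ v ∈ H.verts, hammingDist c v ≤ 1 := by
  obtain ⟨S, hS, ⟨e⟩⟩ := hH
  obtain ⟨s, hs, hst⟩ := hS.exists_center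
  refine ⟨e.symm ⟨s, hs⟩, (e.symm ⟨s, hs⟩).2, fun v hv => ?_⟩
  by_cases h : (e ⟨v, hv⟩ : Fin 1 ⊕ Fin r) = s
  · have : e.symm ⟨s, hs⟩ = ⟨v, hv⟩ := by
      rw [RelIso.symm_apply_eq]
      exact Subtype.ext h.symm
    simp [this]
  · have hadj : S.coe.Adj ⟨s, hs⟩ (e ⟨v, hv⟩) := hst _ (e ⟨v, hv⟩).2 h
    rw [← e.apply_symm_apply ⟨s, hs⟩, e.map_adj_iff] at hadj
    exact le_of_eq (H.adj_sub hadj)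

theorem succ_le_encard_of_isSubstructureCut {n r k : ℕ} {F : Set (hypercube n).Subgraph}
    (hF : IsSubstructureCut (hypercube n) (starGraphK r) F) (hk : 2 * k < n) :
    ((k + 1 : ℕ) : ℕ∞) ≤ F.encard := by
  classical
  by_contra hlt
  have hle : F.encard ≤ k := by
    rw [not_le, Nat.cast_add, Nat.cast_one] at hlt
    exact Order.le_of_lt_add_one hlt
  obtain ⟨hfin, hcard⟩ := Set.encard_le_coe_iff.mp hle
  obtain ⟨m, hm, hmk⟩ := hcard
  choose! c hcmem hc using fun H hH => exists_center (hF.1 H hH)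
  have hFcard : hfin.toFinset.card = m := by
    rw [hfin.encard_eq_coe_toFinset_card] at hm
    exact_mod_cast hm
  refine hF.2 (preconnected_induce n (hfin.toFinset.image c) ∅ _ ?_ (by simp) ?_ ?_)
  · intro x hx hxA
    obtain ⟨H, hH, rfl⟩ := Finset.mem_image.mp hx
    rw [Set.Finite.mem_toFinset] at hH
    exact hxA H hH (hcmem H hH)
  · intro v hv
    rw [Set.mem_ofPred_eq] at hv
    push Not at hv
    obtain ⟨H, hH, hvH⟩ := hv
    exact Or.inr ⟨c H, Finset.mem_image_of_mem _ (hfin.mem_toFinset.mpr hH), hc H hH v hvH⟩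
  · have := Finset.card_image_le (s := hfin.toFinset) (f := c)
    rw [Finset.card_empty]
    omega

/-! ### Upper bound by explicit stars -/

theorem flip_injective {n : ℕ} (u : Fin n → Bool) : Function.Injective (flip u) := by
  intro j k h
  by_contra hjk
  have := congrFun h j
  simp [flip, hjk] at this

/-- The copy of `K_{1,r}` with centre `c` and leaves obtained by flipping the positions `f l`. -/
def starCopy {n r : ℕ} (f : Fin r ↪ Fin n) (c : Fin n → Bool) :
    SimpleGraph.Copy (starGraphK r) (hypercube n) where
  toHom :=
    { toFun := Sum.elim (fun _ => c) fun l => flip c (f l)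
      map_rel' := by
        rintro (a | a) (b | b) h
        · simp at h
        · exact hammingDist_flip c (f b)
        · exact (hammingDist_comm _ _).trans (hammingDist_flip c (f a))
        · simp at h }
  injective' := by
    have hne (l : Fin r) : c ≠ flip c (f l) := fun h => by
      have := hammingDist_flip c (f l)
      rw [← h, hammingDist_self] at this
      omega
    rintro (a | a) (b | b) h
    · rw [Subsingleton.elim a b]
    · exact absurd h (hne b)
    · exact absurd h.symm (hne a)
    · rw [f.injective (flip_injective c h)]

theorem mem_verts_starCopy {n r : ℕ} (f : Fin r ↪ Fin n) (c v : Fin n → Bool) :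
    v ∈ (starCopy f c).toSubgraph.verts ↔ v = c ∨ ∃ l, v = flip c (f l) := by
  have h : v ∈ (starCopy f c).toSubgraph.verts ↔ ∃ x, starCopy f c x = v := by simp
  rw [h]
  constructor
  · rintro ⟨a | l, rfl⟩
    · exact Or.inl rfl
    · exact Or.inr ⟨l, rfl⟩
  · rintro (rfl | ⟨l, rfl⟩)
    · exact ⟨Sum.inl 0, rfl⟩
    · exact ⟨Sum.inr l, rfl⟩

/-- The stars delete every neighbour of `u` but neither `u` nor `v`, so `u` is isolated. -/
theorem structureConnectivity_le {n r k : ℕ} (f : Fin r ↪ Fin n) (c : Fin k → Fin n → Bool)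
    (u v : Fin n → Bool) (huv : u ≠ v)
    (hu : ∀ i, u ≠ c i ∧ ∀ l, u ≠ flip (c i) (f l))
    (hv : ∀ i, v ≠ c i ∧ ∀ l, v ≠ flip (c i) (f l))
    (hcover : ∀ j, ∃ i l, flip u j = flip (c i) (f l)) :
    structureConnectivity (hypercube n) (starGraphK r) ≤ k := by
  let F : Set (hypercube n).Subgraph := Set.range fun i => (starCopy f (c i)).toSubgraph
  have hF : F.encard ≤ k := by
    have := Set.encard_image_le (fun i => (starCopy f (c i)).toSubgraph) Set.univ
    rwa [Set.image_univ, Set.encard_univ, ENat.card_eq_coe_fintype_card, Fintype.card_fin] at this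
  have halive {x : Fin n → Bool} (hx : ∀ i, x ≠ c i ∧ ∀ l, x ≠ flip (c i) (f l)) :
      ∀ H ∈ F, x ∉ H.verts := by
    rintro _ ⟨i, rfl⟩ h
    rcases (mem_verts_starCopy f (c i) x).mp h with h | ⟨l, h⟩
    · exact (hx i).1 h
    · exact (hx i).2 l h
  have hcut : IsStructureCut (hypercube n) (starGraphK r) F := by
    refine ⟨?_, fun hcon => ?_⟩
    · rintro _ ⟨i, rfl⟩
      exact ⟨(starCopy f (c i)).isoToSubgraph.symm⟩
    · obtain ⟨⟨w, hw⟩, hadj⟩ := (hcon ⟨u, halive hu⟩ ⟨v, halive hv⟩).exists_adj_left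
        (fun h => huv (congrArg Subtype.val h))
      obtain ⟨j, rfl⟩ := eq_flip_of_hammingDist_eq_one (show hammingDist u w = 1 from hadj)
      obtain ⟨i, l, h⟩ := hcover j
      exact hw _ ⟨i, rfl⟩ ((mem_verts_starCopy f (c i) _).mpr (Or.inr ⟨l, h⟩))
  exact le_trans (sInf_le (Exists.intro F ⟨hcut, rfl⟩)) hF

end hypercube

theorem substructureConnectivity_le_structureConnectivity {V : Type*} (G : SimpleGraph V) (r : ℕ) :
    substructureConnectivity G (starGraphK r) ≤ structureConnectivity G (starGraphK r) := by
  refine sInf_le_sInf ?_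
  rintro _ ⟨F, hF, rfl⟩
  refine ⟨F, ⟨fun H hH => ⟨⊤, ?_, ?_⟩, hF.2⟩, rfl⟩
  · rw [SimpleGraph.Subgraph.connected_iff', SimpleGraph.Subgraph.topIso.connected_iff]
    have hub (x : Fin 1 ⊕ Fin r) : (starGraphK r).Reachable x (Sum.inl 0) := by
      rcases x with a | l
      · rw [Subsingleton.elim a 0]
      · exact SimpleGraph.Adj.reachable (by simp)
    exact { preconnected := fun x y => (hub x).trans (hub y).symm, nonempty := ⟨Sum.inl 0⟩ }
  · obtain ⟨e⟩ := hF.1 H hH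
    exact ⟨e.trans SimpleGraph.Subgraph.topIso.symm⟩

theorem theorem4p8 :
    (structureConnectivity (hypercube 6) (starGraphK 6) = 3 ∧
      substructureConnectivity (hypercube 6) (starGraphK 6) = 3) ∧
    (structureConnectivity (hypercube 7) (starGraphK 6) = 4 ∧
      substructureConnectivity (hypercube 7) (starGraphK 6) = 4) := by
  have lower {n k : ℕ} (hk : 2 * k < n) :
      ((k + 1 : ℕ) : ℕ∞) ≤ substructureConnectivity (hypercube n) (starGraphK 6) :=
    le_sInf fun _ ⟨_, hF, h⟩ => h ▸ hypercube.succ_le_encard_of_isSubstructureCut hF hk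
  have sub (n : ℕ) := substructureConnectivity_le_structureConnectivity (hypercube n) 6
  -- The centre with index `i` has its ones at `2i` and `2i + 1`; flipping either leaves a neighbour
  -- of the zero string.
  have upper6 : structureConnectivity (hypercube 6) (starGraphK 6) ≤ (3 : ℕ) :=
    hypercube.structureConnectivity_le (Function.Embedding.refl _)
      (fun i j => decide (j.1 / 2 = i.1)) (fun _ => false) (fun _ => true)
      (by decide) (by decide) (by decide) (by decide)
  -- The stars never flip position 6. The fourth centre has ones at 0 and 6, so flipping 0 covers
  -- the last neighbour.
  have upper7 : structureConnectivity (hypercube 7) (starGraphK 6) ≤ (4 : ℕ) :=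
    hypercube.structureConnectivity_le Fin.castSuccEmb
      (fun i j => decide (j.1 / 2 = i.1 ∨ i = 3 ∧ j = 0)) (fun _ => false) (fun _ => true)
      (by decide) (by decide) (by decide) (by decide)
  have lower6 := lower (n := 6) (k := 2) (by norm_num)
  have lower7 := lower (n := 7) (k := 3) (by norm_num)
  exact ⟨⟨le_antisymm upper6 (lower6.trans (sub 6)), le_antisymm ((sub 6).trans upper6) lower6⟩,
    le_antisymm upper7 (lower7.trans (sub 7)), le_antisymm ((sub 7).trans upper7) lower7⟩
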